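/- Let $0<\alpha\le 2$, let $\theta\in\mathbb R$ with $|\theta|\le\min(\pi\alpha/2,\ \pi-\pi\alpha/2)$, let $\lambda>0$ and let $k\ge 1$ be an integer. Let $\mu$ be a generalized Linnik law $\mathrm{GL}(\alpha,\theta,1/k)$, that is, a probability measure on $\mathbb R$ with characteristic function $$\phi(u)=\frac{1}{\bigl[1+\lambda|u|^{\alpha}e^{-i\theta\,\mathrm{sgn}(u)}\bigr]^{1/k}},\qquad u\in\mathbb R,$$ with the principal branch of the $k$-th root. Then $\mu$ belongs to class L (is self-decomposable): for every $c\in(0,1)$ there is a probability measure $\rho_c$ on $\mathbb R$ such that, if $X$ has law $\mu$, $Y$ has law $\rho_c$, and $X$, $Y$ are independent, then $cX+Y$ has law $\mu$. -/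

import Mathlib

open MeasureTheory

/-- The function `u ↦ 1 / [1 + lam |u| ^ α e^{-i θ sgn u}] ^ ν`. The power is the principal one; for
`lam > 0` and `|θ| ≤ π / 2` the bracket has real part at least `1`, so that this is the branch which
is continuous in `u` and equal to `1` at `u = 0`. -/
noncomputable def generalizedLinnikCF (α θ lam ν u : ℝ) : ℂ :=
  1 / (1 + (lam : ℂ) * ((|u| ^ α : ℝ) : ℂ) *
    Complex.exp (-(Complex.I * (θ : ℂ) * ((Real.sign u : ℝ) : ℂ)))) ^ (ν : ℂ)

/-- `μ` is the generalized Linnik law `GL(α, θ, ν)` with scale `lam`: the probability law on the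
line with characteristic function `generalizedLinnikCF α θ lam ν`. -/
def IsGeneralizedLinnik (μ : Measure ℝ) (α θ lam ν : ℝ) : Prop :=
  IsProbabilityMeasure μ ∧ ∀ u : ℝ, charFun μ u = generalizedLinnikCF α θ lam ν u

/-- `μ` belongs to class L (is self-decomposable): `μ` is a probability law on the line and, for
every `0 < c < 1`, it is the law of `c X + Y` with `X` distributed as `μ` and `Y` a random variable
independent of `X` (with some law `ρ` depending on `c`). -/
def IsClassL (μ : Measure ℝ) : Prop :=
  IsProbabilityMeasure μ ∧ ∀ c : ℝ, 0 < c → c < 1 →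
    ∃ ρ : Measure ℝ, IsProbabilityMeasure ρ ∧ μ = (μ.map (fun x => c * x)).conv ρ

/-! Put `z = lam |u|^α e^{-iθ sgn u}`, `s = c^α`, `ν = 1/k`. Then `φ(u) = (1 + z)^(-ν)`, `φ(cu) = (1
+ s z)^(-ν)`, and with `w = 1 / (1 + s z)` the quotient `φ(u) / φ(cu)` is `(s / (1 - (1 - s) w))^ν`,
the negative binomial generating function at `w`. Since `ν = 1/k`, `w = φ(cu)^k` is the
characteristic function of the `k`-fold convolution of the law of `cX`. So `Y` is a negative
binomial compound of that convolution. All bases stay in the right half-plane, which keeps principal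
powers multiplicative (`one_div_one_add_cpow_eq`). -/

/-- The principal power is multiplicative on the open right half-plane. -/
theorem Complex.mul_cpow_of_re_pos {x y : ℂ} (hx : 0 < x.re) (hy : 0 < y.re) (a : ℂ) :
    (x * y) ^ a = x ^ a * y ^ a := by
  have hx0 : x ≠ 0 := fun h => by simp [h] at hx
  have hy0 : y ≠ 0 := fun h => by simp [h] at hy
  have h1 := abs_lt.1 (Complex.abs_arg_lt_pi_div_two_iff.2 (Or.inl hx))
  have h2 := abs_lt.1 (Complex.abs_arg_lt_pi_div_two_iff.2 (Or.inl hy))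
  rw [Complex.cpow_def_of_ne_zero (mul_ne_zero hx0 hy0), Complex.cpow_def_of_ne_zero hx0,
    Complex.cpow_def_of_ne_zero hy0, ← Complex.exp_add, ← add_mul,
    Complex.log_mul hx0 hy0 ⟨by linarith [h1.1, h2.1], by linarith [h1.2, h2.2]⟩]

/-- The coefficients of the negative binomial series are nonnegative. -/
theorem Ring.choose_add_sub_one_nonneg {ν : ℝ} (hν : 0 ≤ ν) (n : ℕ) :
    0 ≤ Ring.choose (ν + n - 1) n := by
  have h := Ring.factorial_nsmul_multichoose_eq_ascPochhammer ν n
  rw [Polynomial.ascPochhammer_smeval_eq_eval, Ring.multichoose_eq, nsmul_eq_mul] at h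
  have h2 : 0 ≤ (ascPochhammer ℝ n).eval ν := by
    rcases hν.eq_or_lt with rfl | hν
    · rw [ascPochhammer_eval_zero]; split_ifs <;> norm_num
    · exact (ascPochhammer_pos n ν hν).le
  rw [← h] at h2
  exact nonneg_of_mul_nonneg_right h2 (by exact_mod_cast n.factorial_pos)

/-- The negative binomial series on the complex unit disc. -/
theorem Complex.hasSum_one_div_one_sub_cpow (a : ℂ) {x : ℂ} (hx : ‖x‖ < 1) :
    HasSum (fun n : ℕ => Ring.choose (a + n - 1) n * x ^ n) (1 / (1 - x) ^ a) := by
  have h := (Complex.one_div_one_sub_cpow_hasFPowerSeriesOnBall_zero a).hasSum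
    (y := x) (by simpa [Metric.mem_eball, edist_zero_right, ← ofReal_norm] using hx)
  simpa [FormalMultilinearSeries.ofScalars_apply_eq, mul_comm] using h

/-- The negative binomial probabilities with parameters `ν` and `s`. -/
noncomputable def negBinomialWeight (ν s : ℝ) (n : ℕ) : ℝ :=
  s ^ ν * Ring.choose (ν + n - 1) n * (1 - s) ^ n

theorem negBinomialWeight_nonneg {ν s : ℝ} (hν : 0 ≤ ν) (hs0 : 0 ≤ s) (hs1 : s ≤ 1) (n : ℕ) :
    0 ≤ negBinomialWeight ν s n :=
  mul_nonneg (mul_nonneg (Real.rpow_nonneg hs0 _) (Ring.choose_add_sub_one_nonneg hν n))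
    (pow_nonneg (by linarith) n)

/-- The generating function of the negative binomial probabilities. -/
theorem hasSum_negBinomialWeight_mul_pow {ν s : ℝ} (hs0 : 0 < s) (hs1 : s ≤ 1)
    {w : ℂ} (hw : ‖w‖ ≤ 1) :
    HasSum (fun n => (negBinomialWeight ν s n : ℂ) * w ^ n)
      ((s : ℂ) ^ (ν : ℂ) * (1 / (1 - (1 - s) * w) ^ (ν : ℂ))) := by
  have hx : ‖((1 - s : ℝ) : ℂ) * w‖ < 1 := by
    rw [norm_mul, Complex.norm_real, Real.norm_of_nonneg (by linarith)]
    nlinarith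
  have h := (Complex.hasSum_one_div_one_sub_cpow (ν : ℂ) hx).mul_left ((s : ℂ) ^ (ν : ℂ))
  have hcoeff (n : ℕ) :
      ((Ring.choose (ν + n - 1) n : ℝ) : ℂ) = Ring.choose ((ν : ℂ) + n - 1) n := by
    rw [Complex.ofReal_choose]; push_cast; rfl
  have hsub : ((1 - s : ℝ) : ℂ) = 1 - s := by push_cast; rfl
  rw [hsub] at h
  have hterm (n : ℕ) : (negBinomialWeight ν s n : ℂ) * w ^ n = (s : ℂ) ^ (ν : ℂ) *
      (Ring.choose ((ν : ℂ) + n - 1) n * ((1 - s) * w) ^ n) := by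
    rw [negBinomialWeight, mul_pow, Complex.ofReal_mul, Complex.ofReal_mul, hcoeff,
      Complex.ofReal_cpow hs0.le, Complex.ofReal_pow, hsub]
    ring
  simp only [hterm]
  exact h

theorem hasSum_negBinomialWeight {ν s : ℝ} (hs0 : 0 < s) (hs1 : s ≤ 1) :
    HasSum (negBinomialWeight ν s) 1 := by
  have h := hasSum_negBinomialWeight_mul_pow (ν := ν) hs0 hs1 (w := 1) (by simp)
  have hs : (s : ℂ) ^ (ν : ℂ) ≠ 0 := by
    simp [Complex.cpow_eq_zero_iff, hs0.ne']
  rw [mul_one, sub_sub_cancel, mul_one_div_cancel hs] at h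
  exact_mod_cast (by simpa using h :
    HasSum (fun n => (negBinomialWeight ν s n : ℂ)) ((1 : ℝ) : ℂ))

/-- Every power of a characteristic function is a characteristic function. -/
theorem exists_charFun_eq_pow (μ : Measure ℝ) [IsProbabilityMeasure μ] (n : ℕ) :
    ∃ ν : Measure ℝ, IsProbabilityMeasure ν ∧ ∀ u, charFun ν u = charFun μ u ^ n := by
  induction n with
  | zero => exact ⟨Measure.dirac 0, inferInstance, fun u => by simp [charFun_dirac]⟩
  | succ n ih =>
    obtain ⟨ν, hν, h⟩ := ih
    exact ⟨ν.conv μ, inferInstance, fun u => by rw [charFun_conv, h, pow_succ]⟩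

/-- A countable convex combination of characteristic functions is a characteristic function. -/
theorem exists_charFun_hasSum {p : ℕ → ℝ} (hp : ∀ n, 0 ≤ p n) (hp1 : HasSum p 1)
    (ν : ℕ → Measure ℝ) [∀ n, IsProbabilityMeasure (ν n)] :
    ∃ ρ : Measure ℝ, IsProbabilityMeasure ρ ∧
      ∀ u, HasSum (fun n => (p n : ℂ) * charFun (ν n) u) (charFun ρ u) := by
  have hρ : IsProbabilityMeasure (Measure.sum fun n => ENNReal.ofReal (p n) • ν n) := by
    constructor
    rw [Measure.sum_apply _ MeasurableSet.univ]
    simp [← ENNReal.ofReal_tsum_of_nonneg hp hp1.summable, hp1.tsum_eq]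
  refine ⟨_, hρ, fun u => ?_⟩
  have hint : Integrable (fun x : ℝ => Complex.exp (inner ℝ x u * Complex.I))
      (Measure.sum fun n => ENNReal.ofReal (p n) • ν n) := by
    refine Integrable.of_bound (C := 1) (by fun_prop) (.of_forall fun x => ?_)
    rw [Complex.norm_exp_ofReal_mul_I]
  simpa only [charFun, integral_smul_measure, ENNReal.toReal_ofReal (hp _), Complex.real_smul]
    using hasSum_integral_measure hint

/-- A negative binomial compound of a probability law on the line. -/
theorem exists_charFun_eq_negBinomial_compound {ν s : ℝ} (hν : 0 ≤ ν) (hs0 : 0 < s) (hs1 : s ≤ 1)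
    (μ : Measure ℝ) [IsProbabilityMeasure μ] :
    ∃ ρ : Measure ℝ, IsProbabilityMeasure ρ ∧
      ∀ u, charFun ρ u = (s : ℂ) ^ (ν : ℂ) * (1 / (1 - (1 - s) * charFun μ u) ^ (ν : ℂ)) := by
  choose κ hκ hκu using exists_charFun_eq_pow μ
  obtain ⟨ρ, hρ, h⟩ := exists_charFun_hasSum (negBinomialWeight_nonneg hν hs0.le hs1)
    (hasSum_negBinomialWeight hs0 hs1) κ
  refine ⟨ρ, hρ, fun u => (h u).unique ?_⟩
  simpa only [hκu] using
    hasSum_negBinomialWeight_mul_pow (ν := ν) hs0 hs1 (norm_charFun_le_one (μ := μ) u)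

/-- For `1 + z` in the right half-plane and `w = 1 / (1 + s z)`, the function `(1 + z) ^ (-ν)`
factors through the negative binomial generating function at `w`. -/
theorem one_div_one_add_cpow_eq {z : ℂ} (hz : 0 ≤ z.re) {s : ℝ} (hs0 : 0 < s) (ν : ℝ) :
    1 / (1 + z) ^ (ν : ℂ) = 1 / (1 + s * z) ^ (ν : ℂ) *
      ((s : ℂ) ^ (ν : ℂ) * (1 / (1 - (1 - s) * (1 / (1 + s * z))) ^ (ν : ℂ))) := by
  have hA : 0 < (1 + z).re := by simp; linarith
  have hBre : 1 ≤ (1 + s * z).re := by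
    simp only [Complex.add_re, Complex.one_re, Complex.re_ofReal_mul]
    nlinarith [mul_nonneg hs0.le hz]
  have hB : 0 < (1 + s * z).re := by linarith
  have hB0 : (1 + s * z) ≠ 0 := fun h => by simp [h] at hB
  have hC : 1 - (1 - (s : ℂ)) * (1 / (1 + s * z)) = s * ((1 + z) / (1 + s * z)) := by
    field_simp; ring
  have hCre : 0 < (1 - (1 - (s : ℂ)) * (1 / (1 + s * z))).re := by
    have hinv : 0 ≤ (1 / (1 + s * z)).re ∧ (1 / (1 + s * z)).re ≤ 1 := by
      rw [one_div]
      refine ⟨by rw [Complex.inv_re]; exact div_nonneg hB.le (Complex.normSq_nonneg _), (Complex.re_le_norm _).trans ?_⟩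
      rw [norm_inv]
      exact inv_le_one_of_one_le₀ (hBre.trans (Complex.re_le_norm _))
    have : (1 - (1 - (s : ℂ)) * (1 / (1 + s * z))).re = 1 - (1 - s) * (1 / (1 + s * z)).re := by
      rw [Complex.sub_re, Complex.one_re, ← Complex.ofReal_one, ← Complex.ofReal_sub,
        Complex.re_ofReal_mul]
    rw [this]
    -- With `r` the real part of `1 / (1 + s z)`, `1 - (1 - s) r = (1 - r) + s r`, which is at least
    -- `s r`.
    rcases hinv.1.eq_or_lt with h | h
    · rw [← h]; simp
    · nlinarith [hinv.2, mul_pos hs0 h]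
  have hmul := Complex.mul_cpow_of_re_pos hB hCre (ν : ℂ)
  have hprod : (1 + s * z) * (1 - (1 - (s : ℂ)) * (1 / (1 + s * z))) = s * (1 + z) := by
    rw [hC]; field_simp
  rw [hprod, Complex.mul_cpow_of_re_pos (by simpa using hs0) hA] at hmul
  have hs : (s : ℂ) ^ (ν : ℂ) ≠ 0 := by simp [Complex.cpow_eq_zero_iff, hs0.ne']
  calc 1 / (1 + z) ^ (ν : ℂ)
      = (s : ℂ) ^ (ν : ℂ) / ((s : ℂ) ^ (ν : ℂ) * (1 + z) ^ (ν : ℂ)) := by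
        rw [div_mul_eq_div_div, div_self hs]
    _ = _ := by rw [hmul]; simp only [div_eq_mul_inv, mul_inv]; ring

/-- The perturbation `lam |u| ^ α e^{-i θ sgn u}` lies in the closed right half-plane. -/
theorem linnik_exponent_re_nonneg {α θ lam : ℝ} (hθ : |θ| ≤ Real.pi / 2) (hlam : 0 ≤ lam) (u : ℝ) :
    0 ≤ ((lam : ℂ) * ((|u| ^ α : ℝ) : ℂ) *
      Complex.exp (-(Complex.I * (θ : ℂ) * ((Real.sign u : ℝ) : ℂ)))).re := by
  rw [← Complex.ofReal_mul, Complex.re_ofReal_mul,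
    show -(Complex.I * (θ : ℂ) * ((Real.sign u : ℝ) : ℂ))
      = ((-(θ * Real.sign u) : ℝ) : ℂ) * Complex.I by push_cast; ring,
    Complex.exp_ofReal_mul_I_re, Real.cos_neg]
  refine mul_nonneg (mul_nonneg hlam (Real.rpow_nonneg (abs_nonneg u) α)) ?_
  have h : |θ * Real.sign u| ≤ Real.pi / 2 := by
    refine le_trans ?_ hθ
    rw [abs_mul]
    refine mul_le_of_le_one_right (abs_nonneg θ) ?_
    rcases Real.sign_apply_eq u with h | h | h <;> simp [h]
  exact Real.cos_nonneg_of_mem_Icc (abs_le.1 h)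

/-- Scaling the argument by `c` multiplies the perturbation by `c ^ α`. -/
theorem generalizedLinnikCF_mul {c : ℝ} (hc : 0 < c) (α θ lam ν u : ℝ) :
    generalizedLinnikCF α θ lam ν (c * u) =
      1 / (1 + ((c ^ α : ℝ) : ℂ) * ((lam : ℂ) * ((|u| ^ α : ℝ) : ℂ) *
        Complex.exp (-(Complex.I * (θ : ℂ) * ((Real.sign u : ℝ) : ℂ))))) ^ (ν : ℂ) := by
  have hsign : Real.sign (c * u) = Real.sign u := by
    rcases lt_trichotomy u 0 with h | rfl | h
    · rw [Real.sign_of_neg h, Real.sign_of_neg (mul_neg_of_pos_of_neg hc h)]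
    · simp
    · rw [Real.sign_of_pos h, Real.sign_of_pos (mul_pos hc h)]
  rw [generalizedLinnikCF, hsign, abs_mul, abs_of_pos hc, Real.mul_rpow hc.le (abs_nonneg u)]
  push_cast
  ring_nf

theorem theorem2p3 (α θ lam : ℝ) (k : ℕ) (hα0 : 0 < α) (hα2 : α ≤ 2)
    (hθ : |θ| ≤ min (Real.pi * α / 2) (Real.pi - Real.pi * α / 2))
    (hlam : 0 < lam) (hk : 0 < k)
    (μ : Measure ℝ) (hμ : IsGeneralizedLinnik μ α θ lam (1 / (k : ℝ))) :
    IsClassL μ := by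
  obtain ⟨hprob, hcf⟩ := hμ
  refine ⟨hprob, fun c hc0 hc1 => ?_⟩
  -- The two bounds on `|θ|` add up to `π`.
  have hθ' : |θ| ≤ Real.pi / 2 := by
    have := le_min_iff.1 hθ
    linarith
  have hs0 : 0 < c ^ α := Real.rpow_pos_of_pos hc0 α
  have hs1 : c ^ α ≤ 1 := Real.rpow_le_one hc0.le hc1.le hα0.le
  have hmap : IsProbabilityMeasure (μ.map fun x => c * x) :=
    Measure.isProbabilityMeasure_map (by fun_prop)
  have hmapcf (u : ℝ) : charFun (μ.map fun x => c * x) u = charFun μ (c * u) := by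
    simpa using charFun_map_smul (μ := μ) c u
  -- The `k`-th power undoes the `k`-th root, so `κ` has characteristic function `1 / (1 + c^α z)`.
  obtain ⟨κ, hκ, hκu⟩ := exists_charFun_eq_pow (μ.map fun x => c * x) k
  obtain ⟨ρ, hρ, hρu⟩ := exists_charFun_eq_negBinomial_compound (ν := 1 / (k : ℝ))
    (by positivity) hs0 hs1 κ
  refine ⟨ρ, hρ, Measure.ext_of_charFun (funext fun u => ?_)⟩
  rw [charFun_conv, hρu, hκu, hmapcf, hcf (c * u), generalizedLinnikCF_mul hc0, hcf u,
    generalizedLinnikCF, one_div_one_add_cpow_eq (linnik_exponent_re_nonneg hθ' hlam.le u) hs0]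
  -- What remains is `1 / (1 + s z) = (1 / (1 + s z)^(1/k))^k`, valid for the principal root as `k ≠
  -- 0`.
  congr 5
  rw [div_pow, one_pow, one_div (k : ℝ), Complex.ofReal_inv, Complex.ofReal_natCast,
    Complex.cpow_nat_inv_pow _ hk.ne']
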